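/- Let $\Omega=\{-1,1\}$ and let $\Omega^{\mathbb N}$ carry the uniform product probability measure; let $\omega$ denote a uniformly random element. For $f:\Omega^{\mathbb N}\to\Omega$ and an input $\omega$, a set $W\subseteq\mathbb N$ is a witness set for $f$ at $\omega$ if, for almost every $\tilde\omega$, the condition $\tilde\omega_i=\omega_i$ for all $i\in W$ implies $f(\tilde\omega)=f(\omega)$. The function $f$ is finitary if almost every input has a finite witness set. For a finite set $S\subset\mathbb N$ put $\chi_S(\omega)=\prod_{i\in S}\omega_i$ and $\hat f(S)=\mathbb E[f\chi_S]$. For $k \in \mathbb N$ the energy of $f$ at level $k$ is $$E_f(k)=\sum_{S\subset\mathbb N,\ |S|=k}\hat f(S)^2 .$$ A (randomised) algorithm $A$ for $f$ queries the bits of $\omega$ one at a time, the choice of the next bit, or the decision to stop, depending only on the queries made and answers received so far and on auxiliary randomness $\theta$ independent of $\omega$; it is required that, almost surely, $A$ stops after finitely many queries and the set $W(A)=W(A)(\omega,\theta)$ of bits it looked at is a witness set for $f$ at $\omega$. The revealment of $f$ is $$\delta_f=\inf_A\ \sup_{i\in\mathbb N}\ \mathbb P\big(i\in W(A)\big),$$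 the infimum being over all algorithms $A$ for $f$. Then for every finitary function $f:\Omega^{\mathbb N}\to\Omega$ and every integer $k\ge 1$, the sum defining $E_f(k)$ converges and $$E_f(k)\ \le\ \delta_f\, k\,\|f\|_2^2 ,$$ where $\|f\|_2$ is the norm of $f$ in $L^2(\Omega^{\mathbb N})$. -/

import Mathlib

open MeasureTheory
open scoped ENNReal

noncomputable section

namespace FinitaryBoolean

/-- The space `{-1,1}^ℕ` of infinite bit sequences; a bit is an element of the group `{1,-1}`. -/
abbrev Cube : Type := ℕ → ℤˣ

/-- The uniform probability measure on `{-1,1}`. -/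
def bitMeasure : Measure ℤˣ :=
  (2⁻¹ : ℝ≥0∞) • Measure.dirac 1 + (2⁻¹ : ℝ≥0∞) • Measure.dirac (-1)

instance instIsProbabilityMeasureBitMeasure : IsProbabilityMeasure bitMeasure :=
  ⟨by simp [bitMeasure, ENNReal.inv_two_add_inv_two]⟩

/-- The uniform (product) probability measure on `{-1,1}^ℕ`. -/
def unif : Measure Cube := Measure.infinitePi fun _ : ℕ => bitMeasure

instance instIsProbabilityMeasureUnif : IsProbabilityMeasure unif := by
  unfold unif; infer_instance

/-- `W` is a witness set for `f` at `ω`: the bits of `ω` in `W` almost surely determine `f ω`. -/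
def IsWitness (f : Cube → ℤˣ) (ω : Cube) (W : Set ℕ) : Prop :=
  ∀ᵐ ω' ∂unif, (∀ i ∈ W, ω' i = ω i) → f ω' = f ω

/-- A Boolean function is finitary if almost every input has a finite witness set. -/
def IsFinitary (f : Cube → ℤˣ) : Prop :=
  ∀ᵐ ω ∂unif, ∃ W : Finset ℕ, IsWitness f ω (W : Set ℕ)

/-- The real-valued function underlying a Boolean function. -/
def toRealFun (f : Cube → ℤˣ) : Cube → ℝ := fun ω => ((f ω : ℤ) : ℝ)

/-- The character `χ_S(ω) = ∏_{i ∈ S} ω_i`. -/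
def character (S : Finset ℕ) : Cube → ℝ := fun ω => ∏ i ∈ S, ((ω i : ℤ) : ℝ)

/-- The Fourier-Walsh coefficient `E[g χ_S]`. -/
def fourierWalshCoeff (g : Cube → ℝ) (S : Finset ℕ) : ℝ := ∫ ω, g ω * character S ω ∂unif

/-- The energy of `g` at level `k`: the sum of the squared Fourier-Walsh coefficients over all
finite sets of cardinality `k`. -/
def energy (g : Cube → ℝ) (k : ℕ) : ℝ :=
  ∑' S : {S : Finset ℕ // S.card = k}, fourierWalshCoeff g S ^ 2

/-- A randomised procedure that queries bits one at a time. The auxiliary randomness `θ` lives on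
an arbitrary probability space; `next θ h` is the next bit to be queried (or `none` to halt) when
`h` is the list of the queries made so far together with their answers, most recent first. -/
structure QueryAlgorithm where
  /-- The sample space of the auxiliary randomness. -/
  Θ : Type
  /-- Its σ-algebra. -/
  [mΘ : MeasurableSpace Θ]
  /-- The law of the auxiliary randomness. -/
  law : Measure Θ
  [prob : IsProbabilityMeasure law]
  /-- The decision rule. -/
  next : Θ → List (ℕ × ℤˣ) → Option ℕ
  measurable_next : ∀ (h : List (ℕ × ℤˣ)) (o : Option ℕ), MeasurableSet {θ | next θ h = o}

attribute [instance] QueryAlgorithm.mΘ QueryAlgorithm.prob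

namespace QueryAlgorithm

/-- The queries and answers of the first `n` steps of the run on input `ω` with randomness `θ`. -/
def history (A : QueryAlgorithm) (ω : Cube) (θ : A.Θ) : ℕ → List (ℕ × ℤˣ)
  | 0 => []
  | n + 1 =>
    match A.next θ (history A ω θ n) with
    | none => history A ω θ n
    | some i => (i, ω i) :: history A ω θ n

/-- The run on input `ω` with randomness `θ` stops after finitely many steps. -/
def Halts (A : QueryAlgorithm) (ω : Cube) (θ : A.Θ) : Prop :=
  ∃ n, A.next θ (A.history ω θ n) = none

/-- The set `W(A)(ω, θ)` of all bits looked at during the run. -/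
def queried (A : QueryAlgorithm) (ω : Cube) (θ : A.Θ) : Set ℕ :=
  {i | ∃ n, A.next θ (A.history ω θ n) = some i}

/-- The joint law of the uniform input and the independent auxiliary randomness. -/
def jointLaw (A : QueryAlgorithm) : Measure (Cube × A.Θ) := unif.prod A.law

/-- `A` is a (finitary) algorithm for `f`: almost surely it stops after finitely many queries, and
when it stops it knows the value of `f`, i.e. the bits it looked at form a witness set. -/
def Computes (A : QueryAlgorithm) (f : Cube → ℤˣ) : Prop :=
  ∀ᵐ x ∂A.jointLaw, A.Halts x.1 x.2 ∧ IsWitness f x.1 (A.queried x.1 x.2)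

/-- The probability that `A` looks at bit `i`. -/
def bitRevealment (A : QueryAlgorithm) (i : ℕ) : ℝ :=
  A.jointLaw.real {x | i ∈ A.queried x.1 x.2}

/-- The revealment of an algorithm. -/
def revealment (A : QueryAlgorithm) : ℝ := ⨆ i, A.bitRevealment i

end QueryAlgorithm

/-- The revealment `δ_f` of a Boolean function: the infimum of the revealments of the algorithms
for it. -/
def revealment (f : Cube → ℤˣ) : ℝ :=
  ⨅ A : {A : QueryAlgorithm // A.Computes f}, A.1.revealment

end FinitaryBoolean

end

/-!
A Boolean function takes the values `±1`, so its `L²` norm is `1` and the claim is that the level-`k`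
Fourier-Walsh weight is at most `k δ` for every algorithm `A` of revealment `δ` computing `f`.

For a finite set `S` let the revealed character `R_S` be `χ_S` on the event that `A` looks at some bit
of `S`, and `0` elsewhere. Under the joint law of the input and the auxiliary randomness, three facts
hold for nonempty sets of size `k`:

* `⟨f, R_S⟩` is the Fourier-Walsh coefficient of `f` at `S`
  (`QueryAlgorithm.Computes.integral_mul_revealedCharacter`);
* `R_S` and `R_T` are orthogonal for `S ≠ T`
  (`QueryAlgorithm.integral_revealedCharacter_mul`);
* `‖R_S‖²` is the probability that `A` looks at some bit of `S`, at most `k δ` by a union bound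
  (`QueryAlgorithm.integral_revealedCharacter_mul_self`,
  `QueryAlgorithm.measureReal_compl_unseen_le`).

Bessel's inequality (`sum_sq_integral_mul_le`) then bounds the sum of the squared coefficients by
`k δ`.

The first two facts rest on one symmetry. Flipping the bit `i` preserves the uniform measure, and it
leaves the whole run unchanged when `A` does not look at `i`; then it leaves `f` unchanged as well,
since what `A` has seen determines `f`. Hence a quantity that changes sign under such a flip has mean
zero on the event that a set containing `i` is unseen (`QueryAlgorithm.integral_unseen_eq_zero`). For
the first fact any `i ∈ S` works; for the second, `S` and `T` have the same size, so each contains a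
bit outside the other.

Witness sets speak about almost every input, whereas a flip produces one particular input. This is
reconciled by `ae_eq_resolvedValue`: there are only countably many finite patterns, so outside one
null set the value of `f` is read off from any finite pattern that forces it. The same lemma shows
that a finitary function is almost everywhere measurable, and that reading the bits in order until
they force the value is an algorithm for it, so that the infimum defining the revealment ranges over
a nonempty set (`computes_sequentialAlgorithm`).
-/

noncomputable section

namespace FinitaryBoolean

/-! ### Flipping a bit -/

instance instDiscreteMeasurableSpaceBit : DiscreteMeasurableSpace ℤˣ where
  forall_measurableSet s := by
    refine ⟨Units.val '' s, .of_discrete, ?_⟩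
    exact Set.preimage_image_eq s Units.val_injective

/-- The input `ω` with its bit at `i` negated. -/
def flip (i : ℕ) (ω : Cube) : Cube := fun j => if j = i then -ω j else ω j

theorem flip_same (i : ℕ) (ω : Cube) : flip i ω i = -ω i := by simp [flip]

theorem flip_of_ne {i j : ℕ} (h : j ≠ i) (ω : Cube) : flip i ω j = ω j := by simp [flip, h]

theorem flip_flip (i : ℕ) (ω : Cube) : flip i (flip i ω) = ω := by
  ext j; by_cases h : j = i <;> simp [flip, h]

theorem measurable_flip (i : ℕ) : Measurable (flip i) := by
  refine measurable_pi_lambda _ fun j => ?_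
  exact (Measurable.of_discrete (f := fun b : ℤˣ => if j = i then -b else b)).comp
    (measurable_pi_apply j)

theorem map_neg_bitMeasure : bitMeasure.map (fun b => -b) = bitMeasure := by
  have h : Measurable (fun b : ℤˣ => -b) := .of_discrete
  rw [bitMeasure, Measure.map_add _ _ h, Measure.map_smul, Measure.map_smul,
    Measure.map_dirac' h, Measure.map_dirac' h, neg_neg, add_comm]

theorem measurePreserving_flip (i : ℕ) : MeasurePreserving (flip i) unif unif := by
  refine ⟨measurable_flip i, ?_⟩
  have h := Measure.infinitePi_map_pi (fun _ : ℕ => bitMeasure)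
    (f := fun j (b : ℤˣ) => if j = i then -b else b) (fun _ => .of_discrete)
  refine h.trans ?_
  rw [unif]
  congr 1
  ext1 j
  by_cases hj : j = i
  · simpa [hj] using map_neg_bitMeasure
  · simp [hj]

/-! ### Characters -/

theorem measurable_character (S : Finset ℕ) : Measurable (character S) :=
  Finset.measurable_fun_prod _ fun i _ =>
    (Measurable.of_discrete (f := fun b : ℤˣ => ((b : ℤ) : ℝ))).comp (measurable_pi_apply i)

theorem bit_mul_self (b : ℤˣ) : ((b : ℤ) : ℝ) * ((b : ℤ) : ℝ) = 1 := by
  rcases Int.units_eq_one_or b with rfl | rfl <;> simp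

theorem abs_bit (b : ℤˣ) : |((b : ℤ) : ℝ)| = 1 := by
  rcases Int.units_eq_one_or b with rfl | rfl <;> simp

theorem character_mul_self (S : Finset ℕ) (ω : Cube) : character S ω * character S ω = 1 := by
  simp [character, ← Finset.prod_mul_distrib, bit_mul_self]

theorem abs_character (S : Finset ℕ) (ω : Cube) : |character S ω| = 1 := by
  simp [character, Finset.abs_prod, abs_bit]

theorem character_flip_of_mem {S : Finset ℕ} {i : ℕ} (h : i ∈ S) (ω : Cube) :
    character S (flip i ω) = -character S ω := by
  unfold character
  rw [← Finset.mul_prod_erase S _ h, ← Finset.mul_prod_erase S (fun j => ((ω j : ℤ) : ℝ)) h,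
    flip_same, Finset.prod_congr rfl fun j hj => by rw [flip_of_ne (Finset.ne_of_mem_erase hj)]]
  push_cast
  ring

theorem character_flip_of_notMem {S : Finset ℕ} {i : ℕ} (h : i ∉ S) (ω : Cube) :
    character S (flip i ω) = character S ω :=
  Finset.prod_congr rfl fun j hj => by rw [flip_of_ne (ne_of_mem_of_not_mem hj h)]

/-! ### Witness sets and finite patterns -/

/-- The pattern of `ω` on `V`, encoded as the set of positions in `V` where the bit is `1`. -/
def plusBits (V : Finset ℕ) (ω : Cube) : Finset ℕ := V.filter fun i => ω i = 1

theorem plusBits_eq_iff {V : Finset ℕ} {ω ω' : Cube} :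
    plusBits V ω' = plusBits V ω ↔ ∀ i ∈ V, ω' i = ω i := by
  simp only [plusBits, Finset.filter_inj']
  refine forall₂_congr fun i _ => ?_
  rcases Int.units_eq_one_or (ω i) with h | h <;> rcases Int.units_eq_one_or (ω' i) with h' | h' <;>
    simp [h, h']

theorem measurableSet_plusBits_eq (V T : Finset ℕ) : MeasurableSet {ω | plusBits V ω = T} := by
  by_cases h : ∃ ω₀, plusBits V ω₀ = T
  · obtain ⟨ω₀, rfl⟩ := h
    simp only [plusBits_eq_iff, Set.ofPred_forall]
    exact .iInter fun i => .iInter fun _ => measurableSet_eq_fun (measurable_pi_apply i)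
      measurable_const
  · push Not at h
    simp [h]

theorem IsWitness.mono {f : Cube → ℤˣ} {ω : Cube} {V W : Set ℕ} (h : IsWitness f ω V)
    (hVW : V ⊆ W) : IsWitness f ω W := by
  filter_upwards [h] with ω' hω' hW using hω' fun i hi => hW i (hVW hi)

/-- The pattern `T` on `V` determines the value of `f` almost surely. -/
def Resolves (f : Cube → ℤˣ) (V T : Finset ℕ) : Prop :=
  ∃ ω₀, plusBits V ω₀ = T ∧ IsWitness f ω₀ V

open Classical in
/-- The value of `f` forced by the pattern `T` on `V`; the value `1` for a pattern that does not
resolve `f` is a placeholder. -/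
def resolvedValue (f : Cube → ℤˣ) (V T : Finset ℕ) : ℤˣ :=
  if h : Resolves f V T then f h.choose else 1

theorem IsWitness.resolves {f : Cube → ℤˣ} {ω : Cube} {V : Finset ℕ} (h : IsWitness f ω V) :
    Resolves f V (plusBits V ω) := ⟨ω, rfl, h⟩

/-- Although being a witness set is defined input by input, there are only countably many finite
patterns, so outside one null set the value of `f` is forced by every resolving pattern. -/
theorem ae_eq_resolvedValue (f : Cube → ℤˣ) :
    ∀ᵐ ω ∂unif, ∀ V : Finset ℕ, Resolves f V (plusBits V ω) →
      f ω = resolvedValue f V (plusBits V ω) := by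
  have h : ∀ V T : Finset ℕ, ∀ᵐ ω ∂unif, plusBits V ω = T → Resolves f V T →
      f ω = resolvedValue f V T := by
    intro V T
    by_cases hT : Resolves f V T
    · filter_upwards [hT.choose_spec.2] with ω hω h _
      rw [resolvedValue, dif_pos hT]
      exact hω (plusBits_eq_iff.1 (h.trans hT.choose_spec.1.symm))
    · exact .of_forall fun _ _ h => absurd h hT
  filter_upwards [ae_all_iff.2 fun V => ae_all_iff.2 (h V)] with ω hω V hV using hω V _ rfl hV

theorem ae_isWitness_of_resolves (f : Cube → ℤˣ) :
    ∀ᵐ ω ∂unif, ∀ V : Finset ℕ, Resolves f V (plusBits V ω) → IsWitness f ω V := by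
  filter_upwards [ae_eq_resolvedValue f] with ω hω V hV
  filter_upwards [ae_eq_resolvedValue f] with ω' hω' h
  have hp := plusBits_eq_iff.2 h
  rw [hω V hV, hω' V (hp ▸ hV), hp]

theorem aestronglyMeasurable_toRealFun {f : Cube → ℤˣ} (hf : IsFinitary f) :
    AEStronglyMeasurable (toRealFun f) unif := by
  classical
  -- Up to a null set, `{f = 1}` is the union of the cylinders forcing the value `1`.
  let E : Set Cube := ⋃ V : Finset ℕ, ⋃ T : Finset ℕ, ⋃ _ : Resolves f V T ∧
    resolvedValue f V T = 1, {ω | plusBits V ω = T}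
  have hE : MeasurableSet E := .iUnion fun V => .iUnion fun T => .iUnion fun _ =>
    measurableSet_plusBits_eq V T
  refine ⟨E.piecewise (fun _ => 1) (fun _ => -1),
    (Measurable.piecewise hE measurable_const measurable_const).stronglyMeasurable, ?_⟩
  filter_upwards [hf, ae_eq_resolvedValue f] with ω ⟨V, hV⟩ hω
  have hmem : ω ∈ E ↔ f ω = 1 := by
    simp only [E, Set.mem_iUnion, Set.mem_ofPred_eq]
    constructor
    · rintro ⟨V', T, ⟨hR, h1⟩, rfl⟩
      rw [hω V' hR, h1]
    · intro h
      exact ⟨V, _, ⟨hV.resolves, by rw [← hω V hV.resolves, h]⟩, rfl⟩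
  rcases Int.units_eq_one_or (f ω) with h | h
  · rw [Set.piecewise_eq_of_mem _ _ _ (hmem.2 h)]
    simp [toRealFun, h]
  · rw [Set.piecewise_eq_of_notMem _ _ _ fun hm => by simp [hmem.1 hm] at h]
    simp [toRealFun, h]

/-! ### Runs of a query algorithm -/

namespace QueryAlgorithm

variable (A : QueryAlgorithm)

instance instIsProbabilityMeasureJointLaw : IsProbabilityMeasure A.jointLaw := by
  unfold jointLaw; infer_instance

theorem measurePreserving_fst_jointLaw : MeasurePreserving Prod.fst A.jointLaw unif :=
  measurePreserving_fst

theorem integral_fst_jointLaw (g : Cube → ℝ) :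
    ∫ x, g x.1 ∂A.jointLaw = ∫ ω, g ω ∂unif := by
  simp [jointLaw, integral_fun_fst]

variable {A}

theorem history_add_of_eq_none {ω : Cube} {θ : A.Θ} {n : ℕ}
    (h : A.next θ (A.history ω θ n) = none) (m : ℕ) :
    A.history ω θ (n + m) = A.history ω θ n := by
  induction m with
  | zero => rfl
  | succ m ih =>
    rw [← Nat.add_assoc, history, ih, h]

theorem Halts.finite_queried {ω : Cube} {θ : A.Θ} (h : A.Halts ω θ) :
    (A.queried ω θ).Finite := by
  obtain ⟨n, hn⟩ := h
  refine ((Set.finite_lt_nat n).image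
    fun m => (A.next θ (A.history ω θ m)).getD 0).subset ?_
  rintro i ⟨m, hm⟩
  refine ⟨m, ?_, by simp [hm]⟩
  by_contra! hnm
  obtain ⟨l, rfl⟩ := Nat.exists_eq_add_of_le (not_lt.1 hnm)
  rw [history_add_of_eq_none hn, hn] at hm
  cases hm

/-- The run does not notice the flip of a bit that it never looks at. -/
theorem history_flip {ω : Cube} {θ : A.Θ} {i : ℕ} (h : i ∉ A.queried ω θ) (n : ℕ) :
    A.history (flip i ω) θ n = A.history ω θ n := by
  induction n with
  | zero => rfl
  | succ n ih =>
    rw [history, history, ih]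
    cases hn : A.next θ (A.history ω θ n) with
    | none => rfl
    | some j =>
      have hj : j ≠ i := by
        rintro rfl
        exact h ⟨n, hn⟩
      simp [flip_of_ne hj]

theorem queried_flip {ω : Cube} {θ : A.Θ} {i : ℕ} (h : i ∉ A.queried ω θ) :
    A.queried (flip i ω) θ = A.queried ω θ := by
  simp [queried, history_flip h]

theorem notMem_queried_flip_iff {ω : Cube} {θ : A.Θ} {i : ℕ} :
    i ∉ A.queried (flip i ω) θ ↔ i ∉ A.queried ω θ := by
  constructor
  · intro h
    have := queried_flip h
    rw [flip_flip] at this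
    rwa [this]
  · intro h
    rwa [queried_flip h]

variable (A)

theorem measurableSet_history_eq (n : ℕ) (h : List (ℕ × ℤˣ)) :
    MeasurableSet {x : Cube × A.Θ | A.history x.1 x.2 n = h} := by
  induction n generalizing h with
  | zero => simp [history]
  | succ n ih =>
    have : {x : Cube × A.Θ | A.history x.1 x.2 (n + 1) = h} =
        {x | A.history x.1 x.2 n = h ∧ A.next x.2 h = none} ∪
        ⋃ g : List (ℕ × ℤˣ), ⋃ i : ℕ,
          {x | A.history x.1 x.2 n = g ∧ A.next x.2 g = some i} ∩
            {x | (i, x.1 i) :: g = h} := by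
      ext x
      simp only [Set.mem_ofPred_eq, Set.mem_union, Set.mem_iUnion, Set.mem_inter_iff, history]
      cases hx : A.next x.2 (A.history x.1 x.2 n) with
      | none =>
        constructor
        · rintro rfl
          exact .inl ⟨rfl, hx⟩
        · rintro (⟨h1, -⟩ | ⟨g, i, ⟨rfl, h2⟩, -⟩)
          · exact h1
          · simp [hx] at h2
      | some j =>
        constructor
        · intro h1
          exact .inr ⟨_, j, ⟨rfl, hx⟩, h1⟩
        · rintro (⟨rfl, h2⟩ | ⟨g, i, ⟨rfl, h2⟩, h3⟩)
          · simp [hx] at h2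
          · rw [hx, Option.some_inj] at h2
            subst h2
            exact h3
    rw [this]
    have key : ∀ g o, MeasurableSet
        {x : Cube × A.Θ | A.history x.1 x.2 n = g ∧ A.next x.2 g = o} :=
      fun g o => (ih g).inter (measurable_snd (A.measurable_next g o))
    refine (key h none).union (.iUnion fun g => .iUnion fun i => (key g (some i)).inter ?_)
    have hm : Measurable fun x : Cube × A.Θ => x.1 i := (measurable_pi_apply i).comp measurable_fst
    exact hm (t := {b | (i, b) :: g = h}) .of_discrete

theorem measurableSet_mem_queried (i : ℕ) :
    MeasurableSet {x : Cube × A.Θ | i ∈ A.queried x.1 x.2} := by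
  have : {x : Cube × A.Θ | i ∈ A.queried x.1 x.2} = ⋃ n : ℕ, ⋃ h : List (ℕ × ℤˣ),
      {x | A.history x.1 x.2 n = h ∧ A.next x.2 h = some i} := by
    ext x
    simp [queried]
  rw [this]
  exact .iUnion fun n => .iUnion fun h => 
    (A.measurableSet_history_eq n h).inter (measurable_snd (A.measurable_next h _))

theorem bitRevealment_le_revealment (i : ℕ) : A.bitRevealment i ≤ A.revealment :=
  le_ciSup (f := A.bitRevealment)
    ⟨1, by rintro _ ⟨j, rfl⟩; exact measureReal_le_one⟩ i

end QueryAlgorithm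

/-! ### Every finitary function has an algorithm -/

/-- The queries and answers after the bits `0, …, m - 1` have been read in order. -/
def sequentialHistory (ω : Cube) : ℕ → List (ℕ × ℤˣ)
  | 0 => []
  | m + 1 => (m, ω m) :: sequentialHistory ω m

theorem length_sequentialHistory (ω : Cube) (m : ℕ) : (sequentialHistory ω m).length = m := by
  induction m with
  | zero => rfl
  | succ m ih => simp [sequentialHistory, ih]

theorem mem_sequentialHistory {ω : Cube} {m : ℕ} {p : ℕ × ℤˣ} :
    p ∈ sequentialHistory ω m ↔ p.1 < m ∧ ω p.1 = p.2 := by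
  induction m with
  | zero => simp [sequentialHistory]
  | succ m ih =>
    rw [sequentialHistory, List.mem_cons, ih, Nat.lt_succ_iff_lt_or_eq, Prod.ext_iff]
    grind

open Classical in
/-- The deterministic algorithm reading the bits `0, 1, 2, …` in order until the answers force the
value of `f`. -/
def sequentialAlgorithm (f : Cube → ℤˣ) : QueryAlgorithm where
  Θ := Unit
  law := Measure.dirac ()
  next _ h := if ∃ ω₀, (∀ p ∈ h, ω₀ p.1 = p.2) ∧ IsWitness f ω₀ (Finset.range h.length)
    then none else some h.length
  measurable_next _ _ := .of_discrete

theorem next_sequentialHistory (f : Cube → ℤˣ) (θ : Unit) (ω : Cube) (m : ℕ) :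
    ((sequentialAlgorithm f).next θ (sequentialHistory ω m) = none ∧
      Resolves f (Finset.range m) (plusBits (Finset.range m) ω)) ∨
    ((sequentialAlgorithm f).next θ (sequentialHistory ω m) = some m ∧
      ¬ Resolves f (Finset.range m) (plusBits (Finset.range m) ω)) := by
  have h : (∃ ω₀, (∀ p ∈ sequentialHistory ω m, ω₀ p.1 = p.2) ∧ IsWitness f ω₀
      (Finset.range (sequentialHistory ω m).length)) ↔
      Resolves f (Finset.range m) (plusBits (Finset.range m) ω) := by
    rw [length_sequentialHistory]
    refine exists_congr fun ω₀ => and_congr_left fun _ => ?_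
    rw [plusBits_eq_iff]
    constructor
    · intro h i hi
      exact h (i, ω i) (mem_sequentialHistory.2 ⟨Finset.mem_range.1 hi, rfl⟩)
    · intro h p hp
      obtain ⟨h1, h2⟩ := mem_sequentialHistory.1 hp
      rw [h _ (Finset.mem_range.2 h1), h2]
  by_cases hR : Resolves f (Finset.range m) (plusBits (Finset.range m) ω)
  · exact .inl ⟨if_pos (h.2 hR), hR⟩
  · refine .inr ⟨(if_neg (mt h.1 hR)).trans ?_, hR⟩
    rw [length_sequentialHistory]

theorem computes_sequentialAlgorithm {f : Cube → ℤˣ} (hf : IsFinitary f) :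
    (sequentialAlgorithm f).Computes f := by
  classical
  have h := hf.and (ae_isWitness_of_resolves f)
  filter_upwards
    [(sequentialAlgorithm f).measurePreserving_fst_jointLaw.quasiMeasurePreserving.ae h]
    with ⟨ω, θ⟩ ⟨⟨V, hV⟩, hω⟩
  simp only at hV hω ⊢
  have hex : ∃ m, Resolves f (Finset.range m) (plusBits (Finset.range m) ω) := by
    obtain ⟨m, hm⟩ := V.exists_nat_subset_range
    exact ⟨m, (hV.mono (Finset.coe_subset.2 hm)).resolves⟩
  have hnext : ∀ m < Nat.find hex,
      (sequentialAlgorithm f).next θ (sequentialHistory ω m) = some m := fun m hm =>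
    ((next_sequentialHistory f θ ω m).resolve_left fun h => Nat.find_min hex hm h.2).1
  have hhist : ∀ m ≤ Nat.find hex,
      (sequentialAlgorithm f).history ω θ m = sequentialHistory ω m := by
    intro m hm
    induction m with
    | zero => rfl
    | succ m ih =>
      rw [QueryAlgorithm.history, ih (Nat.le_of_succ_le hm), hnext m hm]
      rfl
  refine ⟨⟨Nat.find hex, ?_⟩, (hω _ (Nat.find_spec hex)).mono fun i hi => ?_⟩
  · rw [hhist _ le_rfl]
    exact ((next_sequentialHistory f θ ω _).resolve_right fun h => h.2 (Nat.find_spec hex)).1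
  · have hi' := Finset.mem_range.1 (Finset.mem_coe.1 hi)
    exact ⟨i, by rw [hhist i hi'.le, hnext i hi']⟩

/-! ### Revealed characters -/

namespace QueryAlgorithm

variable (A : QueryAlgorithm)

/-- The event that the run looks at none of the bits in `S`. -/
def unseen (S : Finset ℕ) : Set (Cube × A.Θ) := {x | ∀ i ∈ S, i ∉ A.queried x.1 x.2}

theorem measurableSet_unseen (S : Finset ℕ) : MeasurableSet (A.unseen S) := by
  simp only [unseen, Set.ofPred_forall]
  exact .iInter fun i => .iInter fun _ => (A.measurableSet_mem_queried i).compl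

theorem mem_unseen_flip {S : Finset ℕ} {i : ℕ} {x : Cube × A.Θ}
    (h : i ∉ A.queried x.1 x.2) : (flip i x.1, x.2) ∈ A.unseen S ↔ x ∈ A.unseen S := by
  simp [unseen, queried_flip h]

theorem measureReal_compl_unseen_le (S : Finset ℕ) :
    A.jointLaw.real (A.unseen S)ᶜ ≤ A.revealment * S.card := by
  have h : (A.unseen S)ᶜ = ⋃ i ∈ S, {x | i ∈ A.queried x.1 x.2} := by
    ext x
    simp [unseen]
  calc A.jointLaw.real (A.unseen S)ᶜ
      ≤ ∑ i ∈ S, A.bitRevealment i := h ▸ measureReal_biUnion_finset_le _ _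
    _ ≤ ∑ _i ∈ S, A.revealment := Finset.sum_le_sum fun i _ => A.bitRevealment_le_revealment i
    _ = A.revealment * S.card := by simp [mul_comm]

theorem measurePreserving_flip_jointLaw (i : ℕ) :
    MeasurePreserving (fun x : Cube × A.Θ => (flip i x.1, x.2)) A.jointLaw A.jointLaw :=
  (measurePreserving_flip i).prod (.id A.law)

theorem integral_comp_flip (i : ℕ) (g : Cube × A.Θ → ℝ) :
    ∫ x, g (flip i x.1, x.2) ∂A.jointLaw = ∫ x, g x ∂A.jointLaw := by
  let e : (Cube × A.Θ) ≃ᵐ (Cube × A.Θ) :=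
    { toFun := fun x => (flip i x.1, x.2)
      invFun := fun x => (flip i x.1, x.2)
      left_inv := fun x => by simp [flip_flip]
      right_inv := fun x => by simp [flip_flip]
      measurable_toFun := (A.measurePreserving_flip_jointLaw i).measurable
      measurable_invFun := (A.measurePreserving_flip_jointLaw i).measurable }
  exact (show MeasurePreserving e A.jointLaw A.jointLaw from
    A.measurePreserving_flip_jointLaw i).integral_comp' g

theorem integral_eq_zero_of_flip {i : ℕ} {g : Cube × A.Θ → ℝ}
    (hg : ∀ᵐ x ∂A.jointLaw, g (flip i x.1, x.2) = -g x) : ∫ x, g x ∂A.jointLaw = 0 := by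
  have h := A.integral_comp_flip i g
  rw [integral_congr_ae hg, integral_neg] at h
  linarith

/-- A quantity that is odd under the flip of an unqueried bit `i ∈ S` has mean zero on the event
that `S` is unseen: the flip preserves this event and the law. -/
theorem integral_unseen_eq_zero {S : Finset ℕ} {i : ℕ} (hi : i ∈ S) {g : Cube × A.Θ → ℝ}
    (hg : ∀ᵐ x ∂A.jointLaw, i ∉ A.queried x.1 x.2 → g (flip i x.1, x.2) = -g x) :
    ∫ x, (A.unseen S).indicator g x ∂A.jointLaw = 0 := by
  refine A.integral_eq_zero_of_flip (i := i) ?_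
  filter_upwards [hg] with x hx
  by_cases h : i ∈ A.queried x.1 x.2
  · have h' : i ∈ A.queried (flip i x.1) x.2 := not_not.1 fun hn =>
      notMem_queried_flip_iff.1 hn h
    rw [Set.indicator_of_notMem fun hm : _ ∈ A.unseen S => hm i hi h',
      Set.indicator_of_notMem fun hm : _ ∈ A.unseen S => hm i hi h, neg_zero]
  · by_cases hm : x ∈ A.unseen S
    · rw [Set.indicator_of_mem ((A.mem_unseen_flip h).2 hm), Set.indicator_of_mem hm, hx h]
    · rw [Set.indicator_of_notMem (mt (A.mem_unseen_flip h).1 hm), Set.indicator_of_notMem hm,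
        neg_zero]

/-- The output of an algorithm does not depend on bits that it never looks at. -/
theorem Computes.ae_apply_flip {A : QueryAlgorithm} {f : Cube → ℤˣ} (hA : A.Computes f) (i : ℕ) :
    ∀ᵐ x ∂A.jointLaw, i ∉ A.queried x.1 x.2 → f (flip i x.1) = f x.1 := by
  have h := ae_eq_resolvedValue f
  have h' := A.measurePreserving_fst_jointLaw.quasiMeasurePreserving.ae h
  have h'' := (A.measurePreserving_flip_jointLaw i).quasiMeasurePreserving.ae h'
  filter_upwards [hA, h', h''] with x ⟨hhalt, hW⟩ h1 h2 hi
  have hV : IsWitness f x.1 hhalt.finite_queried.toFinset := by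
    simpa using hW
  have hp : plusBits hhalt.finite_queried.toFinset (flip i x.1) =
      plusBits hhalt.finite_queried.toFinset x.1 :=
    plusBits_eq_iff.2 fun j hj => flip_of_ne (by rintro rfl; exact hi (by simpa using hj)) _
  rw [h1 _ hV.resolves, h2 _ (hp ▸ hV.resolves), hp]

/-- The character `χ_S`, set to zero when the run sees no bit of `S`. -/
def revealedCharacter (S : Finset ℕ) : Cube × A.Θ → ℝ :=
  (A.unseen S)ᶜ.indicator fun x => character S x.1

theorem measurable_character_fst (S : Finset ℕ) :
    Measurable fun x : Cube × A.Θ => character S x.1 :=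
  (measurable_character S).comp measurable_fst

theorem measurable_revealedCharacter (S : Finset ℕ) : Measurable (A.revealedCharacter S) :=
  (A.measurable_character_fst S).indicator (A.measurableSet_unseen S).compl

theorem abs_revealedCharacter_le (S : Finset ℕ) (x : Cube × A.Θ) :
    |A.revealedCharacter S x| ≤ 1 := by
  by_cases hx : x ∈ A.unseen S <;> simp [revealedCharacter, hx, abs_character]

theorem memLp_revealedCharacter (S : Finset ℕ) : MemLp (A.revealedCharacter S) 2 A.jointLaw :=
  .of_bound (A.measurable_revealedCharacter S).aestronglyMeasurable 1
    (.of_forall (A.abs_revealedCharacter_le S))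

theorem memLp_character_fst (S : Finset ℕ) :
    MemLp (fun x : Cube × A.Θ => character S x.1) 2 A.jointLaw :=
  .of_bound (A.measurable_character_fst S).aestronglyMeasurable 1
    (.of_forall fun x => (abs_character S x.1).le)

end QueryAlgorithm

theorem toRealFun_mul_self (f : Cube → ℤˣ) (ω : Cube) : toRealFun f ω * toRealFun f ω = 1 :=
  bit_mul_self _

theorem abs_toRealFun (f : Cube → ℤˣ) (ω : Cube) : |toRealFun f ω| = 1 := abs_bit _

theorem memLp_toRealFun {f : Cube → ℤˣ} (hf : IsFinitary f) : MemLp (toRealFun f) 2 unif :=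
  .of_bound (aestronglyMeasurable_toRealFun hf) 1 (.of_forall fun ω => (abs_toRealFun f ω).le)

namespace QueryAlgorithm

variable {A : QueryAlgorithm}

/-- Given what the run has seen, an entirely unseen character has mean zero while `f` is
determined. -/
theorem Computes.integral_mul_revealedCharacter {f : Cube → ℤˣ} (hf : IsFinitary f)
    (hA : A.Computes f) {S : Finset ℕ} (hS : S.Nonempty) :
    ∫ x, toRealFun f x.1 * A.revealedCharacter S x ∂A.jointLaw =
      fourierWalshCoeff (toRealFun f) S := by
  obtain ⟨i, hi⟩ := hS
  have hint : Integrable (fun x : Cube × A.Θ => toRealFun f x.1 * character S x.1) A.jointLaw :=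
    ((memLp_toRealFun hf).comp_measurePreserving
      A.measurePreserving_fst_jointLaw).integrable_mul (A.memLp_character_fst S)
  have hz := A.integral_unseen_eq_zero hi
    (g := fun x => toRealFun f x.1 * character S x.1) (by
      filter_upwards [hA.ae_apply_flip i] with x hx h
      rw [character_flip_of_mem hi, toRealFun, hx h, toRealFun, mul_neg])
  rw [fourierWalshCoeff, ← A.integral_fst_jointLaw, ← sub_eq_zero, ← neg_eq_zero, neg_sub, ← hz,
    ← integral_sub hint]
  · refine integral_congr_ae (.of_forall fun x => ?_)
    by_cases hx : x ∈ A.unseen S <;> simp [revealedCharacter, hx]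
  · exact ((memLp_toRealFun hf).comp_measurePreserving
      A.measurePreserving_fst_jointLaw).integrable_mul (A.memLp_revealedCharacter S)

variable (A)

theorem integral_revealedCharacter_mul_self (S : Finset ℕ) :
    ∫ x, A.revealedCharacter S x * A.revealedCharacter S x ∂A.jointLaw =
      A.jointLaw.real (A.unseen S)ᶜ := by
  rw [← integral_indicator_one (A.measurableSet_unseen S).compl]
  refine integral_congr_ae (.of_forall fun x => ?_)
  by_cases hx : x ∈ A.unseen S <;> simp [revealedCharacter, hx, character_mul_self]

/-- Revealed characters of distinct sets of the same size are orthogonal. The equality of sizes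
provides, in either set, a bit outside the other. -/
theorem integral_revealedCharacter_mul {S T : Finset ℕ} (hST : S ≠ T) (hcard : S.card = T.card) :
    ∫ x, A.revealedCharacter S x * A.revealedCharacter T x ∂A.jointLaw = 0 := by
  obtain ⟨i, hiS, hiT⟩ : ∃ i ∈ S, i ∉ T := Finset.not_subset.1 fun h =>
    hST (Finset.eq_of_subset_of_card_le h hcard.ge)
  obtain ⟨j, hjT, hjS⟩ : ∃ j ∈ T, j ∉ S := Finset.not_subset.1 fun h =>
    hST (Finset.eq_of_subset_of_card_le h hcard.le).symm
  let g : Cube × A.Θ → ℝ := fun x => character S x.1 * character T x.1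
  have hgi : ∀ x, g (flip i x.1, x.2) = -g x := fun x => by
    simp [g, character_flip_of_mem hiS, character_flip_of_notMem hiT]
  have hgj : ∀ x, g (flip j x.1, x.2) = -g x := fun x => by
    simp [g, character_flip_of_mem hjT, character_flip_of_notMem hjS]
  have hg : Integrable g A.jointLaw := (A.memLp_character_fst S).integrable_mul
    (A.memLp_character_fst T)
  have hmS := A.measurableSet_unseen S
  have hmT := A.measurableSet_unseen T
  have h0 : ∫ x, g x ∂A.jointLaw = 0 := A.integral_eq_zero_of_flip (.of_forall hgi)
  have h1 : ∫ x, (A.unseen S).indicator g x ∂A.jointLaw = 0 :=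
    A.integral_unseen_eq_zero hiS (.of_forall fun x _ => hgi x)
  have h2 : ∫ x, (A.unseen T).indicator g x ∂A.jointLaw = 0 :=
    A.integral_unseen_eq_zero hjT (.of_forall fun x _ => hgj x)
  have h3 : ∫ x, (A.unseen S).indicator ((A.unseen T).indicator g) x ∂A.jointLaw = 0 := by
    refine A.integral_unseen_eq_zero hiS (.of_forall fun x hx => ?_)
    by_cases hm : x ∈ A.unseen T
    · rw [Set.indicator_of_mem ((A.mem_unseen_flip hx).2 hm), Set.indicator_of_mem hm, hgi]
    · rw [Set.indicator_of_notMem (mt (A.mem_unseen_flip hx).1 hm), Set.indicator_of_notMem hm,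
        neg_zero]
  have hsplit : ∀ x, A.revealedCharacter S x * A.revealedCharacter T x =
      (g x - (A.unseen S).indicator g x) -
        ((A.unseen T).indicator g x - (A.unseen S).indicator ((A.unseen T).indicator g) x) := by
    intro x
    by_cases hxS : x ∈ A.unseen S <;> by_cases hxT : x ∈ A.unseen T <;>
      simp [revealedCharacter, hxS, hxT, g]
  simp_rw [hsplit]
  have iS : Integrable (fun x => g x - (A.unseen S).indicator g x) A.jointLaw :=
    hg.sub (hg.indicator hmS)
  have iT : Integrable (fun x => (A.unseen T).indicator g x -
      (A.unseen S).indicator ((A.unseen T).indicator g) x) A.jointLaw :=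
    (hg.indicator hmT).sub ((hg.indicator hmT).indicator hmS)
  rw [integral_sub iS iT, integral_sub hg (hg.indicator hmS),
    integral_sub (hg.indicator hmT) ((hg.indicator hmT).indicator hmS), h0, h1, h2, h3]
  simp

end QueryAlgorithm

/-! ### The energy bound -/

/-- A form of Bessel's inequality: if the `R i` are orthogonal with `‖R i‖² ≤ q`, then the
squared inner products with a function of norm one sum up to at most `q`. -/
theorem sum_sq_integral_mul_le {X ι : Type*} [MeasurableSpace X] {μ : Measure X} {F : X → ℝ}
    (hF : MemLp F 2 μ) (hF1 : ∫ x, F x * F x ∂μ = 1) (s : Finset ι) {R : ι → X → ℝ}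
    (hR : ∀ i ∈ s, MemLp (R i) 2 μ) {q : ℝ} (hq0 : 0 ≤ q)
    (hq : ∀ i ∈ s, ∫ x, R i x * R i x ∂μ ≤ q)
    (horth : ∀ i ∈ s, ∀ j ∈ s, i ≠ j → ∫ x, R i x * R j x ∂μ = 0) :
    ∑ i ∈ s, (∫ x, F x * R i x ∂μ) ^ 2 ≤ q := by
  set a : ι → ℝ := fun i => ∫ x, F x * R i x ∂μ with ha
  set E : ℝ := ∑ i ∈ s, a i ^ 2 with hE
  let Q : X → ℝ := fun x => ∑ i ∈ s, a i * R i x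
  have hQ : MemLp Q 2 μ := memLp_finsetSum s fun i hi => (hR i hi).const_mul (a i)
  have hFQ : ∫ x, F x * Q x ∂μ = E := by
    have h : ∀ x, F x * Q x = ∑ i ∈ s, a i * (F x * R i x) := fun x => by
      simp only [Q, Finset.mul_sum]
      exact Finset.sum_congr rfl fun i _ => by ring
    simp_rw [h]
    have hint : ∀ i ∈ s, Integrable (fun x => a i * (F x * R i x)) μ :=
      fun i hi => (hF.integrable_mul (hR i hi)).const_mul (a i)
    rw [integral_finsetSum s hint]
    exact Finset.sum_congr rfl fun i _ => by rw [integral_const_mul, sq]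
  have hQQ : ∫ x, Q x * Q x ∂μ ≤ q * E := by
    have h : ∀ x, Q x * Q x = ∑ i ∈ s, ∑ j ∈ s, a i * a j * (R i x * R j x) := fun x => by
      simp only [Q, Finset.sum_mul_sum]
      exact Finset.sum_congr rfl fun i _ => Finset.sum_congr rfl fun j _ => by ring
    simp_rw [h]
    have hint : ∀ i ∈ s, ∀ j ∈ s, Integrable (fun x => a i * a j * (R i x * R j x)) μ :=
      fun i hi j hj => ((hR i hi).integrable_mul (hR j hj)).const_mul _
    rw [integral_finsetSum s fun i hi => integrable_finsetSum s (hint i hi), hE, Finset.mul_sum]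
    refine Finset.sum_le_sum fun i hi => ?_
    rw [integral_finsetSum s (hint i hi), Finset.sum_eq_single_of_mem i hi fun j hj hij => by
      rw [integral_const_mul, horth i hi j hj hij.symm, mul_zero], integral_const_mul, ← sq,
      mul_comm q]
    exact mul_le_mul_of_nonneg_left (hq i hi) (sq_nonneg _)
  -- Expand `0 ≤ ∫ (E F - Q)²`, where `E F` is the projection of `Q` onto `F`.
  have hpos : 0 ≤ ∫ x, (E * F x - Q x) * (E * F x - Q x) ∂μ :=
    integral_nonneg fun x => mul_self_nonneg _
  have hexp : ∀ x, (E * F x - Q x) * (E * F x - Q x) =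
      E ^ 2 * (F x * F x) - 2 * E * (F x * Q x) + Q x * Q x := fun x => by ring
  have iFF : Integrable (fun x => E ^ 2 * (F x * F x)) μ := (hF.integrable_mul hF).const_mul _
  have iFQ : Integrable (fun x => 2 * E * (F x * Q x)) μ := (hF.integrable_mul hQ).const_mul _
  have iQQ : Integrable (fun x => Q x * Q x) μ := hQ.integrable_mul hQ
  simp_rw [hexp] at hpos
  have iSub : Integrable (fun x => E ^ 2 * (F x * F x) - 2 * E * (F x * Q x)) μ := iFF.sub iFQ
  rw [integral_add iSub iQQ, integral_sub iFF iFQ, integral_const_mul,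
    integral_const_mul, hF1, hFQ] at hpos
  have hE0 : 0 ≤ E := Finset.sum_nonneg fun i _ => sq_nonneg (a i)
  nlinarith

theorem QueryAlgorithm.Computes.sum_sq_fourierWalshCoeff_le {A : QueryAlgorithm} {f : Cube → ℤˣ}
    (hf : IsFinitary f) (hA : A.Computes f) {k : ℕ} (hk : 1 ≤ k)
    (s : Finset {S : Finset ℕ // S.card = k}) :
    ∑ S ∈ s, fourierWalshCoeff (toRealFun f) S ^ 2 ≤ A.revealment * k := by
  have hA0 : 0 ≤ A.revealment := measureReal_nonneg.trans (A.bitRevealment_le_revealment 0)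
  have h := sum_sq_integral_mul_le (μ := A.jointLaw) (F := fun x => toRealFun f x.1)
    ((memLp_toRealFun hf).comp_measurePreserving A.measurePreserving_fst_jointLaw)
    (by simp [toRealFun_mul_self]) s (R := fun S => A.revealedCharacter S)
    (q := A.revealment * k) (fun S _ => A.memLp_revealedCharacter S) (by positivity)
    (fun S _ => by
      rw [A.integral_revealedCharacter_mul_self]
      simpa [S.2] using A.measureReal_compl_unseen_le S)
    (fun S _ T _ hST => A.integral_revealedCharacter_mul (Subtype.coe_injective.ne hST)
      (S.2.trans T.2.symm))
  refine le_trans (Finset.sum_le_sum fun S _ => ?_) h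
  rw [hA.integral_mul_revealedCharacter hf (Finset.card_pos.1 (hk.trans_eq S.2.symm))]

theorem eLpNorm_toRealFun (f : Cube → ℤˣ) : eLpNorm (toRealFun f) 2 unif = 1 := by
  rw [eLpNorm_congr_norm_ae (g := fun _ => (1 : ℝ)) (.of_forall fun ω => by
    simp [abs_toRealFun]), eLpNorm_const _ two_ne_zero (NeZero.ne _)]
  simp

theorem sum_sq_fourierWalshCoeff_le {f : Cube → ℤˣ} (hf : IsFinitary f) {k : ℕ} (hk : 1 ≤ k)
    (s : Finset {S : Finset ℕ // S.card = k}) :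
    ∑ S ∈ s, fourierWalshCoeff (toRealFun f) S ^ 2 ≤ revealment f * k := by
  have hk0 : (0 : ℝ) < k := by exact_mod_cast hk
  -- Without an algorithm for `f` the infimum would be that of the empty set.
  have : Nonempty {A : QueryAlgorithm // A.Computes f} :=
    ⟨_, computes_sequentialAlgorithm hf⟩
  rw [← div_le_iff₀ hk0]
  refine le_ciInf fun A => ?_
  rw [div_le_iff₀ hk0]
  exact A.2.sum_sq_fourierWalshCoeff_le hf hk s

end FinitaryBoolean

end

theorem mainTheorem8 (f : FinitaryBoolean.Cube → ℤˣ) (hf : FinitaryBoolean.IsFinitary f)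
    (k : ℕ) (hk : 1 ≤ k) :
    Summable (fun S : {S : Finset ℕ // S.card = k} =>
      FinitaryBoolean.fourierWalshCoeff (FinitaryBoolean.toRealFun f) S ^ 2) ∧
    FinitaryBoolean.energy (FinitaryBoolean.toRealFun f) k ≤
      FinitaryBoolean.revealment f * k *
        (MeasureTheory.eLpNorm (FinitaryBoolean.toRealFun f) 2 FinitaryBoolean.unif).toReal ^ 2 := by
  have hsum := summable_of_sum_le (fun _ => sq_nonneg _)
    (FinitaryBoolean.sum_sq_fourierWalshCoeff_le hf hk)
  refine ⟨hsum, ?_⟩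
  rw [FinitaryBoolean.eLpNorm_toRealFun, ENNReal.toReal_one, one_pow, mul_one]
  exact hsum.tsum_le_of_sum_le (FinitaryBoolean.sum_sq_fourierWalshCoeff_le hf hk)
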